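/- Let $n,d\ge 1$ be integers and let $\mathbb R^{2n+3}_1$ be $\mathbb R^{2n+3}$ with the Lorentzian metric $\langle x,y\rangle_L=-x_{2n+3}y_{2n+3}+\sum_{k=1}^{2n+2}x_ky_k$. Put $U^{2n+3}=\{x\mid\langle x,x\rangle_L<0\}$ and $H^{2n+2}=\{x\mid\langle x,x\rangle_L=-1\}$ (both sheets), the latter with the induced Riemannian metric, and let $\pi^*:U^{2n+3}\to H^{2n+2}$, $\pi^*(x)=x/\sqrt{-\langle x,x\rangle_L}$. A smooth map $\phi:M\to\mathbb C$ from a semi-Riemannian manifold is a harmonic morphism if for every harmonic function $f:W\to\mathbb R$ on an open set $W\subset\mathbb C$ with $\phi^{-1}(W)\neq\emptyset$ the composition $f\circ\phi:\phi^{-1}(W)\to\mathbb R$ is harmonic with respect to the Laplace-Beltrami operator of $M$. Let $p:\mathbb R^3\to\mathbb C$, $$p(x)=a_1(x_1^2-x_2^2)+a_2(x_2^2-x_3^2)+b_1x_1x_2+b_2x_1x_3+b_3x_2x_3,\qquad a_1,a_2,b_1,b_2,b_3\in\mathbb C .$$ Then $p$ is horizontally conformal, i.e. $\kappa(p,p)=\sum_{k=1}^3(\partial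 p/\partial x_k)^2=0$ on $\mathbb R^3$, if and only if $$4a_1^2+b_1^2+b_2^2=0,\quad 4a_1a_2=-b_2^2,\quad 2a_1b_3=b_1b_2,\quad 4a_2^2+b_2^2+b_3^2=0 .$$ Assume that $\kappa(p,p)=0$, and let $P_d,Q_d\in\mathbb C[z_1,\dots,z_n]$ be homogeneous polynomials of degree $d$ (the zero polynomial is allowed). Set $z_k=x_{2k+2}+i\,x_{2k+3}$ for $1\le k<n$ and $z_n=x_{2n+2}-x_{2n+3}$. Let $V$ be the set of all $x\in U^{2n+3}$ with $Q_d(z)\neq0$ and, if $d$ is odd, $p(x_1,x_2,x_3)\notin(-\infty,0]$. Define $$\hat\Phi^*_d:V\to\mathbb C,\qquad \hat\Phi_d^*(x)=\frac{p(x_1,x_2,x_3)^{d/2}+P_d(z_1,\dots,z_n)}{Q_d(z_1,\dots,z_n)},$$ where $p^{d/2}=(\sqrt p)^d$ with the standard square root if $d$ is odd. Then: 1. $V$ is open and $\hat\Phi_d^*$ is a harmonic morphism on $V\subset\mathbb R^{2n+3}_1$. 2. $V$ and $\hat\Phi^*_d$ are invariant under multiplication by positive real numbers, and $\hat\Phi_d^*$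 induces a harmonic morphism on an open subset of $H^{2n+2}$: $\pi^*(V)$ is open in $H^{2n+2}$ and there is a harmonic morphism $\Phi_d^*:\pi^*(V)\to\mathbb C$ with $\Phi^*_d\circ\pi^*=\hat\Phi^*_d$ on $V$. 3. If $d$ is even and $Q_d=z_n^d$, then $V=U^{2n+3}$ and $\pi^*(V)=H^{2n+2}$, so that $\hat\Phi_d^*$ is defined on all of $U^{2n+3}$ and $\Phi_d^*$ on all of $H^{2n+2}$. -/

import Mathlib

open scoped ContDiff

noncomputable section

namespace HarmonicMorphism

/-! ### Coordinate calculus -/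

/-- The partial derivative `∂u/∂x_i` at the point `x`. -/
def pderiv {m : ℕ} {F : Type*} [NormedAddCommGroup F] [NormedSpace ℝ F]
    (i : Fin m) (u : (Fin m → ℝ) → F) (x : Fin m → ℝ) : F :=
  fderiv ℝ u x (Pi.single i 1)

/-- The conformality operator `κ(φ, ψ) = ∑ₖ ∂φ/∂xₖ · ∂ψ/∂xₖ` of Euclidean space `ℝᵐ`. -/
def kappa {m : ℕ} (φ ψ : (Fin m → ℝ) → ℂ) (x : Fin m → ℝ) : ℂ :=
  ∑ k, pderiv k φ x * pderiv k ψ x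

/-- The Laplace-Beltrami operator (tension field) of a semi-Riemannian metric `G = (g_ij)`
given in coordinates:
`Δf = |det G|^(-1/2) ∑ᵢ ∂ᵢ ( |det G|^(1/2) ∑ⱼ g^{ij} ∂ⱼ f )`. -/
def laplaceBeltrami {m : ℕ} (G : (Fin m → ℝ) → Matrix (Fin m) (Fin m) ℝ)
    (f : (Fin m → ℝ) → ℝ) (x : Fin m → ℝ) : ℝ :=
  (√|(G x).det|)⁻¹ *
    ∑ i, pderiv i (fun y => √|(G y).det| * ∑ j, (G y)⁻¹ i j * pderiv j f y) x

/-- `f` is a harmonic function on the open set `Ω ⊆ ℝᵐ` equipped with the metric `G`. -/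
def IsHarmonicOn {m : ℕ} (G : (Fin m → ℝ) → Matrix (Fin m) (Fin m) ℝ)
    (f : (Fin m → ℝ) → ℝ) (Ω : Set (Fin m → ℝ)) : Prop :=
  ContDiffOn ℝ 2 f Ω ∧ ∀ x ∈ Ω, laplaceBeltrami G f x = 0

/-- `φ` is a (smooth) harmonic morphism from the open set `Ω ⊆ ℝᵐ`, equipped with the metric `G`,
to the Euclidean plane `ℂ`: it pulls back harmonic functions on open subsets `W` of `ℂ` with
non-empty preimage to harmonic functions. -/
def IsHarmonicMorphismOn {m : ℕ} (G : (Fin m → ℝ) → Matrix (Fin m) (Fin m) ℝ)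
    (φ : (Fin m → ℝ) → ℂ) (Ω : Set (Fin m → ℝ)) : Prop :=
  IsOpen Ω ∧ ContDiffOn ℝ ∞ φ Ω ∧
    ∀ (W : Set ℂ) (f : ℂ → ℝ), IsOpen W → (Ω ∩ φ ⁻¹' W).Nonempty →
      InnerProductSpace.HarmonicOnNhd f W → IsHarmonicOn G (f ∘ φ) (Ω ∩ φ ⁻¹' W)

/-! ### Minkowski space and the hyperbolic space -/

/-- The Lorentzian inner product on `ℝ^{m+1}`; the last coordinate is the timelike one. -/
def lorentz {m : ℕ} (x y : Fin (m + 1) → ℝ) : ℝ :=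
  -(x (Fin.last m) * y (Fin.last m)) + ∑ k : Fin m, x k.castSucc * y k.castSucc

/-- The matrix of the flat Lorentzian metric of `ℝ^{m+1}_1`. -/
def minkowskiMetric (m : ℕ) : (Fin (m + 1) → ℝ) → Matrix (Fin (m + 1)) (Fin (m + 1)) ℝ :=
  fun _ => Matrix.of fun i j => lorentz (Pi.single i 1) (Pi.single j 1)

/-- The timelike cone `U^{m+1}` in `ℝ^{m+1}_1`. -/
def timelikeCone (m : ℕ) : Set (Fin (m + 1) → ℝ) := {x | lorentz x x < 0}

/-- The hyperbolic space `H^m = {x | ⟨x, x⟩_L = -1}` in `ℝ^{m+1}_1`, with both of its sheets. -/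
def hyperbolicSpace (m : ℕ) : Set (Fin (m + 1) → ℝ) := {x | lorentz x x = -1}

/-- The radial projection `x ↦ x / √(-⟨x, x⟩_L)`, from the timelike cone to hyperbolic space. -/
def radialProj {m : ℕ} (x : Fin (m + 1) → ℝ) : Fin (m + 1) → ℝ :=
  (√(-lorentz x x))⁻¹ • x

/-- For `ε = 1` and `ε = -1` the global parametrization `y ↦ (y, ε √(1 + |y|²))` of the upper and
of the lower sheet of `H^m` by `ℝᵐ`; the inverse of a global chart of that sheet. -/
def sheet {m : ℕ} (ε : ℝ) (y : Fin m → ℝ) : Fin (m + 1) → ℝ :=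
  Fin.snoc (α := fun _ => ℝ) y (ε * √(1 + ∑ k, y k ^ 2))

/-- The Riemannian metric of `H^m`, i.e. the one induced from `⟨·, ·⟩_L`, in the coordinates
`sheet ε`: `g_ij = ⟨∂ᵢ(sheet ε), ∂ⱼ(sheet ε)⟩_L`. -/
def hyperbolicMetric (m : ℕ) (ε : ℝ) : (Fin m → ℝ) → Matrix (Fin m) (Fin m) ℝ :=
  fun y => Matrix.of fun i j => lorentz (pderiv i (sheet ε) y) (pderiv j (sheet ε) y)

/-- `Φ` is a harmonic morphism from the open subset `A` of the Riemannian manifold `H^m` to `ℂ`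
(tested in the two global charts of the two sheets). Only the values of `Φ` on `A` matter. -/
def IsHarmonicMorphismOnHyperbolic {m : ℕ} (Φ : (Fin (m + 1) → ℝ) → ℂ)
    (A : Set (Fin (m + 1) → ℝ)) : Prop :=
  A ⊆ hyperbolicSpace m ∧
    ∀ ε : ℝ, ε = 1 ∨ ε = -1 →
      IsHarmonicMorphismOn (hyperbolicMetric m ε) (Φ ∘ sheet ε) (sheet ε ⁻¹' A)

/-! ### The maps -/

/-- The general complex-valued harmonic quadratic form on `ℝ³`. -/
def quad (a₁ a₂ b₁ b₂ b₃ : ℂ) (x : Fin 3 → ℝ) : ℂ :=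
  a₁ * ((x 0 : ℂ) ^ 2 - (x 1 : ℂ) ^ 2) + a₂ * ((x 1 : ℂ) ^ 2 - (x 2 : ℂ) ^ 2)
    + b₁ * (x 0 * x 1) + b₂ * (x 0 * x 2) + b₃ * (x 1 * x 2)

/-- The first three coordinates `(x₁, x₂, x₃)` of a point of `ℝ^{2n+3}`. -/
def firstThree {n : ℕ} (x : Fin (2 * n + 2 + 1) → ℝ) : Fin 3 → ℝ :=
  fun i => x ⟨i, by omega⟩

/-- The substitutions `z_k = x_{2k+2} + i x_{2k+3}` for `k < n` and `z_n = x_{2n+2} - x_{2n+3}`.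
In Lean the indices of `x` and of `z` start at `0` instead of `1`. -/
def zCoord {n : ℕ} (x : Fin (2 * n + 2 + 1) → ℝ) (k : Fin n) : ℂ :=
  if (k : ℕ) + 1 < n then
    (x ⟨2 * k + 3, by omega⟩ : ℂ) + Complex.I * (x ⟨2 * k + 4, by omega⟩ : ℂ)
  else
    (x ⟨2 * k + 3, by omega⟩ : ℂ) - (x ⟨2 * k + 4, by omega⟩ : ℂ)

/-- The map `(p^{d/2} + P(z)) / Q(z)`. The complex power is the principal one: for even `d` it is
the ordinary power with exponent `d/2`, for odd `d` it is `(√p)^d` with the standard root. -/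
def phiHat {n : ℕ} (d : ℕ) (p : (Fin 3 → ℝ) → ℂ) (P Q : MvPolynomial (Fin n) ℂ)
    (x : Fin (2 * n + 2 + 1) → ℝ) : ℂ :=
  (p (firstThree x) ^ ((d : ℂ) / 2) + MvPolynomial.eval (zCoord x) P) /
    MvPolynomial.eval (zCoord x) Q

/-- The domain of `phiHat`: the points of the timelike cone where `Q(z) ≠ 0` and, for odd `d`,
where moreover `p` takes its value outside `(-∞, 0]`. -/
def phiHatDomain {n : ℕ} (d : ℕ) (p : (Fin 3 → ℝ) → ℂ) (Q : MvPolynomial (Fin n) ℂ) :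
    Set (Fin (2 * n + 2 + 1) → ℝ) :=
  {x | x ∈ timelikeCone (2 * n + 2) ∧ MvPolynomial.eval (zCoord x) Q ≠ 0 ∧
    (Odd d → p (firstThree x) ∈ Complex.slitPlane)}

end HarmonicMorphism

end

open HarmonicMorphism

noncomputable section

namespace HarmonicMorphism

open Topology Filter

/-! ### Second derivatives and functions constant along rays -/

section Calculus

variable {E F H : Type*} [NormedAddCommGroup E] [NormedSpace ℝ E]
  [NormedAddCommGroup F] [NormedSpace ℝ F] [NormedAddCommGroup H] [NormedSpace ℝ H]

/-! The map is `G ∘ (p, z)` with `G` holomorphic near every value taken on the domain. The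
components of `(p, z)` are solutions of the wave equation whose Lorentzian gradients are null and
mutually orthogonal: `p` has trace zero and `κ(p, p) = 0`; each `z_k` is linear with null gradient,
because `1 + i² = 0` for a spacelike pair and `1 - (-1)² = 0` for the last pair, which contains the
timelike coordinate; different components involve disjoint variables. By the chain rule the wave
operator therefore annihilates `Re K(p, z)` for every holomorphic `K`. A harmonic `f` is locally `Re
g` with `g` holomorphic, so `f ∘ G ∘ (p, z) = Re (g ∘ G)(p, z)` is harmonic
(`isHarmonicMorphismOn_comp_isotropicCoord`).

For the descent, numerator and denominator scale by `r ^ d` under `x ↦ r x` with `r > 0`, so the map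
is constant along rays. On such functions the wave operator restricts to the Laplacian of hyperbolic
space (`laplaceBeltrami_comp_sheet`), which is verified in the graph charts from the explicit
inverse metric `1 + y yᵀ` and volume density `(1 + |y|²)^(-1/2)`.

The criterion for `κ(p, p) = 0` is a comparison of coefficients of a quadratic form. -/

theorem differentiableAt_fderiv_of_contDiffAt_two {f : E → F} {x : E} (hf : ContDiffAt ℝ 2 f x) :
    DifferentiableAt ℝ (fderiv ℝ f) x :=
  (hf.fderiv_right (m := 1) (by norm_num)).differentiableAt (by norm_num)

theorem eventually_differentiableAt_of_contDiffAt_two {f : E → F} {x : E}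
    (hf : ContDiffAt ℝ 2 f x) : ∀ᶠ y in 𝓝 x, DifferentiableAt ℝ f y :=
  (hf.eventually (by simp)).mono fun _ hy => hy.differentiableAt (by norm_num)

theorem fderiv_fderiv_apply {f : E → F} {x : E} (hf : ContDiffAt ℝ 2 f x) (v w : E) :
    fderiv ℝ (fun y => fderiv ℝ f y w) x v = fderiv ℝ (fderiv ℝ f) x v w := by
  rw [fderiv_clm_apply (differentiableAt_fderiv_of_contDiffAt_two hf) (by fun_prop)]
  simp

/-- The chain rule for second derivatives. -/
theorem fderiv_fderiv_comp {g : F → H} {f : E → F} {x : E} (hg : ContDiffAt ℝ 2 g (f x))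
    (hf : ContDiffAt ℝ 2 f x) (v w : E) :
    fderiv ℝ (fderiv ℝ (g ∘ f)) x v w =
      fderiv ℝ (fderiv ℝ g) (f x) (fderiv ℝ f x v) (fderiv ℝ f x w) +
        fderiv ℝ g (f x) (fderiv ℝ (fderiv ℝ f) x v w) := by
  have hfx : DifferentiableAt ℝ f x := hf.differentiableAt (by norm_num)
  have h : fderiv ℝ (g ∘ f) =ᶠ[𝓝 x] fun y => (fderiv ℝ g (f y)).comp (fderiv ℝ f y) := by
    filter_upwards [eventually_differentiableAt_of_contDiffAt_two hf,
      hf.continuousAt.eventually (eventually_differentiableAt_of_contDiffAt_two hg)] with y h1 h2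
    exact fderiv_comp y h2 h1
  have hg' := differentiableAt_fderiv_of_contDiffAt_two hg
  have hd : DifferentiableAt ℝ (fun y => fderiv ℝ g (f y)) x := hg'.comp x hfx
  rw [h.fderiv_eq, fderiv_clm_comp hd (differentiableAt_fderiv_of_contDiffAt_two hf)]
  have : fderiv ℝ (fun y => fderiv ℝ g (f y)) x = _ := fderiv_comp x hg' hfx
  rw [this]
  simp [add_comm]

/-- A function which is constant along rays near `x` has vanishing radial derivatives. -/
theorem fderiv_self_of_eventually_smul_eq {f : E → F} {x : E} (hf : DifferentiableAt ℝ f x)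
    (h : ∀ᶠ r : ℝ in 𝓝 1, f (r • x) = f x) : fderiv ℝ f x x = 0 := by
  have h1 : HasDerivAt (fun r : ℝ => r • x) x 1 := by
    simpa using (hasDerivAt_id (1 : ℝ)).smul_const x
  have hf' : HasFDerivAt f (fderiv ℝ f x) ((1 : ℝ) • x) := by simpa using hf.hasFDerivAt
  have h2 := hf'.comp_hasDerivAt (1 : ℝ) h1
  have h3 : HasDerivAt (f ∘ fun r : ℝ => r • x) 0 1 :=
    (hasDerivAt_const (1 : ℝ) (f x)).congr_of_eventuallyEq h
  exact h2.unique h3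

/-- Differentiating the identity `Df(y) y = 0` at `x` in the direction `x` gives `D²f(x, x) + Df(x)
x = 0`, and the last term is zero. The identity is needed on a neighbourhood of `x`, hence the form
of the hypothesis. -/
theorem fderiv_fderiv_self_of_eventually_smul_eq {f : E → F} {x : E} (hf : ContDiffAt ℝ 2 f x)
    (h : ∀ᶠ y in 𝓝 x, ∀ᶠ r : ℝ in 𝓝 1, f (r • y) = f y) :
    fderiv ℝ (fderiv ℝ f) x x x = 0 := by
  have h0 : (fun y => fderiv ℝ f y y) =ᶠ[𝓝 x] fun _ => 0 := by
    filter_upwards [h, eventually_differentiableAt_of_contDiffAt_two hf] with y h1 h2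
    exact fderiv_self_of_eventually_smul_eq h2 h1
  have h1 : fderiv ℝ (fun y => fderiv ℝ f y y) x x = 0 := by rw [h0.fderiv_eq]; simp
  rw [fderiv_clm_apply (differentiableAt_fderiv_of_contDiffAt_two hf) differentiableAt_fun_id] at h1
  simpa [h0.eq_of_nhds] using h1

end Calculus

/-! ### Partial derivatives as directional derivatives -/

section Coordinates

variable {m : ℕ} {F : Type*} [NormedAddCommGroup F] [NormedSpace ℝ F]

theorem sum_smul_pderiv (u : (Fin m → ℝ) → F) (x v : Fin m → ℝ) :
    ∑ i, v i • pderiv i u x = fderiv ℝ u x v := by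
  conv_rhs => rw [pi_eq_sum_univ' v]
  simp [pderiv]

theorem pderiv_pderiv {u : (Fin m → ℝ) → F} {x : Fin m → ℝ} (hu : ContDiffAt ℝ 2 u x)
    (i j : Fin m) :
    pderiv i (pderiv j u) x = fderiv ℝ (fderiv ℝ u) x (Pi.single i 1) (Pi.single j 1) :=
  fderiv_fderiv_apply hu _ _

theorem differentiableAt_pderiv {u : (Fin m → ℝ) → F} {x : Fin m → ℝ} (hu : ContDiffAt ℝ 2 u x)
    (j : Fin m) : DifferentiableAt ℝ (pderiv j u) x :=
  (differentiableAt_fderiv_of_contDiffAt_two hu).clm_apply (differentiableAt_const _)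

end Coordinates

/-! ### The wave operator of Minkowski space -/

/-- The signs of the Lorentzian metric. -/
def lorentzSign (m : ℕ) : Fin (m + 1) → ℝ := Fin.snoc (α := fun _ => ℝ) (fun _ => 1) (-1)

@[simp] theorem lorentzSign_last (m : ℕ) : lorentzSign m (Fin.last m) = -1 := by
  simp [lorentzSign]

@[simp] theorem lorentzSign_castSucc {m : ℕ} (i : Fin m) : lorentzSign m i.castSucc = 1 := by
  simp [lorentzSign]

theorem minkowskiMetric_eq (m : ℕ) (x : Fin (m + 1) → ℝ) :
    minkowskiMetric m x = Matrix.diagonal (lorentzSign m) := by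
  ext i j
  refine Fin.lastCases ?_ (fun i => ?_) i <;> refine Fin.lastCases ?_ (fun j => ?_) j <;>
    simp [minkowskiMetric, lorentz, Matrix.diagonal_apply, Pi.single_apply, eq_comm]

theorem laplaceBeltrami_minkowskiMetric {m : ℕ} {f : (Fin (m + 1) → ℝ) → ℝ}
    {x : Fin (m + 1) → ℝ} (hf : ContDiffAt ℝ 2 f x) :
    laplaceBeltrami (minkowskiMetric m) f x =
      ∑ i, lorentzSign m i * fderiv ℝ (fderiv ℝ f) x (Pi.single i 1) (Pi.single i 1) := by
  have hsq : (fun i => lorentzSign m i * lorentzSign m i) = fun _ => 1 := by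
    ext i; refine Fin.lastCases ?_ (fun i => ?_) i <;> simp
  have hinv : (Matrix.diagonal (lorentzSign m))⁻¹ = Matrix.diagonal (lorentzSign m) := by
    refine Matrix.inv_eq_right_inv ?_
    rw [Matrix.diagonal_mul_diagonal, hsq, Matrix.diagonal_one]
  have hdet : (Matrix.diagonal (lorentzSign m)).det = -1 := by
    simp [Matrix.det_diagonal, Fin.prod_univ_castSucc]
  unfold laplaceBeltrami
  simp only [minkowskiMetric_eq, hinv, hdet, abs_neg, abs_one, Real.sqrt_one, inv_one, one_mul,
    Matrix.diagonal_apply, ite_mul, zero_mul, Finset.sum_ite_eq, Finset.mem_univ, if_true]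
  refine Finset.sum_congr rfl fun i _ => ?_
  rw [← pderiv_pderiv hf]
  change fderiv ℝ (fun y => lorentzSign m i * pderiv i f y) x _ = _
  rw [fderiv_const_mul (differentiableAt_pderiv hf i)]
  rfl

/-! ### The Laplace-Beltrami operator of hyperbolic space -/

section Hyperbolic

variable {m : ℕ}

/-- The linear inclusion of the spacelike coordinate hyperplane, followed by a multiple of the
timelike unit vector. -/
def tangentLift (l : (Fin m → ℝ) →L[ℝ] ℝ) : (Fin m → ℝ) →L[ℝ] (Fin (m + 1) → ℝ) :=
  ContinuousLinearMap.pi (Fin.snoc (α := fun _ => (Fin m → ℝ) →L[ℝ] ℝ)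
    (fun i => ContinuousLinearMap.proj i) l)

theorem tangentLift_apply (l : (Fin m → ℝ) →L[ℝ] ℝ) (v : Fin m → ℝ) :
    tangentLift l v = Fin.snoc (α := fun _ => ℝ) v (l v) := by
  ext i
  refine Fin.lastCases ?_ (fun i => ?_) i <;> simp [tangentLift]

theorem one_add_sum_sq_pos (y : Fin m → ℝ) : 0 < 1 + ∑ k, y k ^ 2 := by positivity

/-- The function `√(1 + |y|²)`. -/
def height (y : Fin m → ℝ) : ℝ := √(1 + ∑ k, y k ^ 2)

theorem height_pos (y : Fin m → ℝ) : 0 < height y := Real.sqrt_pos.2 (one_add_sum_sq_pos y)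

theorem height_sq (y : Fin m → ℝ) : height y ^ 2 = 1 + ∑ k, y k ^ 2 :=
  Real.sq_sqrt (one_add_sum_sq_pos y).le

theorem contDiff_height {k : WithTop ℕ∞} : ContDiff ℝ k (height (m := m)) := by
  unfold height
  refine ContDiff.sqrt (by fun_prop) fun y => (one_add_sum_sq_pos y).ne'

theorem differentiable_height : Differentiable ℝ (height (m := m)) :=
  (contDiff_height (k := 1)).differentiable (by simp)

theorem fderiv_height (y v : Fin m → ℝ) :
    fderiv ℝ height y v = (height y)⁻¹ * ∑ k, y k * v k := by
  have h1 : HasFDerivAt (fun y : Fin m → ℝ => 1 + ∑ k, y k ^ 2)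
      (∑ k, (2 * y k) • (ContinuousLinearMap.proj k : (Fin m → ℝ) →L[ℝ] ℝ)) y := by
    refine (HasFDerivAt.fun_sum fun k _ => ?_).const_add 1
    simpa using (hasFDerivAt_apply (𝕜 := ℝ) k y).pow 2
  have h2 := h1.sqrt (one_add_sum_sq_pos y).ne'
  have : fderiv ℝ height y = _ := h2.fderiv
  rw [this]
  have := (height_pos y).ne'
  simp only [smul_apply, sum_apply, smul_eq_mul,
    ContinuousLinearMap.proj_apply]
  rw [show √(1 + ∑ k, y k ^ 2) = height y from rfl, Finset.mul_sum, Finset.mul_sum]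
  refine Finset.sum_congr rfl fun k _ => ?_
  field_simp

theorem sheet_eq (ε : ℝ) (y : Fin m → ℝ) :
    sheet ε y = Fin.snoc (α := fun _ => ℝ) y (ε * height y) := rfl

theorem contDiff_sheet {k : WithTop ℕ∞} (ε : ℝ) : ContDiff ℝ k (sheet (m := m) ε) := by
  refine contDiff_pi.2 fun i => ?_
  refine Fin.lastCases ?_ (fun i => ?_) i
  · simpa [sheet_eq] using contDiff_const.mul contDiff_height
  · simpa [sheet_eq] using contDiff_apply ℝ ℝ i

theorem fderiv_sheet (ε : ℝ) (y v : Fin m → ℝ) :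
    fderiv ℝ (sheet ε) y v =
      Fin.snoc (α := fun _ => ℝ) v (ε * ((height y)⁻¹ * ∑ k, y k * v k)) := by
  have h : HasFDerivAt (sheet ε) (tangentLift (ε • fderiv ℝ height y)) y := by
    refine hasFDerivAt_pi.2 fun i => ?_
    refine Fin.lastCases ?_ (fun i => ?_) i
    · simpa [sheet_eq] using (differentiable_height y).hasFDerivAt.const_mul ε
    · simpa [sheet_eq] using hasFDerivAt_apply (𝕜 := ℝ) i y
  rw [h.fderiv, tangentLift_apply]
  simp [fderiv_height]

/-- Only the timelike component of the graph is nonlinear, so the second derivative is the Hessian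
of `ε √(1 + |y|²)` times the timelike unit vector. -/
theorem fderiv_fderiv_sheet (ε : ℝ) (y v w : Fin m → ℝ) :
    fderiv ℝ (fderiv ℝ (sheet ε)) y v w =
      (ε * ((height y)⁻¹ * (∑ k, v k * w k) -
        ((height y)⁻¹) ^ 3 * (∑ k, y k * v k) * (∑ k, y k * w k))) •
          (Pi.single (Fin.last m) 1 : Fin (m + 1) → ℝ) := by
  have hh := (height_pos y).ne'
  rw [← fderiv_fderiv_apply (contDiff_sheet ε).contDiffAt]
  simp only [fderiv_sheet]
  have h1 : HasFDerivAt (fun y : Fin m → ℝ => (height y)⁻¹)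
      (-(height y ^ 2)⁻¹ • fderiv ℝ height y) y :=
    (hasDerivAt_inv hh).comp_hasFDerivAt y (differentiable_height y).hasFDerivAt
  have h2 : HasFDerivAt (fun y : Fin m → ℝ => ∑ k, y k * w k)
      (∑ k, w k • (ContinuousLinearMap.proj k : (Fin m → ℝ) →L[ℝ] ℝ)) y :=
    HasFDerivAt.fun_sum fun k _ => (hasFDerivAt_apply (𝕜 := ℝ) k y).mul_const (w k)
  have h3 := (h1.mul h2).const_mul ε
  have h : ∀ l : (Fin m → ℝ) →L[ℝ] ℝ,
      HasFDerivAt (fun y : Fin m → ℝ => ε * ((height y)⁻¹ * ∑ k, y k * w k)) l y →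
      HasFDerivAt (fun y : Fin m → ℝ => (Fin.snoc (α := fun _ => ℝ) w
        (ε * ((height y)⁻¹ * ∑ k, y k * w k)) : Fin (m + 1) → ℝ))
        (ContinuousLinearMap.pi
          (Fin.snoc (α := fun _ => (Fin m → ℝ) →L[ℝ] ℝ) (fun _ => 0) l)) y := by
    refine fun l hl => hasFDerivAt_pi.2 fun i => ?_
    refine Fin.lastCases ?_ (fun i => ?_) i
    · simpa using hl
    · simpa using hasFDerivAt_const (w i) y
  rw [(h _ h3).fderiv]
  ext i
  refine Fin.lastCases ?_ (fun i => ?_) i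
  · simp [fderiv_height]
    simp only [mul_comm (w _)]
    field_simp
    ring
  · simp

theorem hyperbolicMetric_eq {ε : ℝ} (hε : ε ^ 2 = 1) (y : Fin m → ℝ) :
    hyperbolicMetric m ε y = 1 - (height y ^ 2)⁻¹ • Matrix.vecMulVec y y := by
  ext i j
  have hh := (height_pos y).ne'
  simp only [hyperbolicMetric, pderiv, fderiv_sheet, lorentz, Matrix.of_apply, Fin.snoc_last,
    Fin.snoc_castSucc, Matrix.sub_apply, Matrix.smul_apply, Matrix.vecMulVec_apply,
    Matrix.one_apply, smul_eq_mul, Pi.single_apply]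
  simp
  field_simp
  rw [hε]
  simp only [eq_comm (a := j)]
  ring

/-- Inversion of a rank-one perturbation: since `|y|² = height² - 1`, the coefficient of `y yᵀ` in
the product is `1 - height⁻² - height⁻² (height² - 1) = 0`. -/
theorem hyperbolicMetric_mul {ε : ℝ} (hε : ε ^ 2 = 1) (y : Fin m → ℝ) :
    hyperbolicMetric m ε y * (1 + Matrix.vecMulVec y y) = 1 := by
  have hh := (height_pos y).ne'
  have h : y ⬝ᵥ y = height y ^ 2 - 1 := by
    rw [height_sq]; simp [dotProduct, sq]
  rw [hyperbolicMetric_eq hε, sub_mul, mul_add, mul_add, Matrix.smul_mul, Matrix.smul_mul,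
    Matrix.vecMulVec_mul_vecMulVec, h]
  ext i j
  simp [Matrix.vecMulVec_apply]
  field_simp
  ring

theorem hyperbolicMetric_inv {ε : ℝ} (hε : ε ^ 2 = 1) (y : Fin m → ℝ) :
    (hyperbolicMetric m ε y)⁻¹ = 1 + Matrix.vecMulVec y y :=
  Matrix.inv_eq_right_inv (hyperbolicMetric_mul hε y)

theorem sqrt_abs_det_hyperbolicMetric {ε : ℝ} (hε : ε ^ 2 = 1) (y : Fin m → ℝ) :
    √|(hyperbolicMetric m ε y).det| = (height y)⁻¹ := by
  have h1 : (1 + Matrix.vecMulVec y y).det = height y ^ 2 := by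
    rw [Matrix.vecMulVec_eq Unit, Matrix.det_one_add_replicateCol_mul_replicateRow, height_sq]
    simp [dotProduct, sq]
  have h2 := congrArg Matrix.det (hyperbolicMetric_mul hε y)
  rw [Matrix.det_mul, h1, Matrix.det_one] at h2
  rw [eq_inv_of_mul_eq_one_left h2, abs_of_pos (by have := height_pos y; positivity),
    Real.sqrt_inv, Real.sqrt_sq (height_pos y).le]

/-- The Laplace-Beltrami operator of hyperbolic space in the coordinates `sheet ε`. -/
theorem laplaceBeltrami_hyperbolicMetric {ε : ℝ} (hε : ε ^ 2 = 1) {f : (Fin m → ℝ) → ℝ}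
    {y : Fin m → ℝ} (hf : ContDiffAt ℝ 2 f y) :
    laplaceBeltrami (hyperbolicMetric m ε) f y =
      ∑ i, fderiv ℝ (fderiv ℝ f) y (Pi.single i 1) (Pi.single i 1) +
        fderiv ℝ (fderiv ℝ f) y y y + m * fderiv ℝ f y y := by
  have hh := (height_pos y).ne'
  have hd := differentiableAt_fderiv_of_contDiffAt_two hf
  have hE : HasFDerivAt (fun x => fderiv ℝ f x x) _ y := hd.hasFDerivAt.clm_apply (hasFDerivAt_id y)
  -- The gradient with raised index is `∂ᵢf + xᵢ Ef`, where `Ef(x) = Df(x) x` is the Euler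
  -- derivative.
  have hsum : ∀ (x : Fin m → ℝ) (i : Fin m),
      ∑ j, (1 + Matrix.vecMulVec x x) i j * pderiv j f x = pderiv i f x + x i * fderiv ℝ f x x := by
    intro x i
    rw [← sum_smul_pderiv f x x, Finset.mul_sum]
    simp [Matrix.add_apply, add_mul, Finset.sum_add_distrib, Matrix.one_apply,
      Matrix.vecMulVec_apply, mul_assoc]
  have hinv : HasFDerivAt (fun y : Fin m → ℝ => (height y)⁻¹)
      (-(height y ^ 2)⁻¹ • fderiv ℝ height y) y :=
    (hasDerivAt_inv hh).comp_hasFDerivAt y (differentiable_height y).hasFDerivAt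
  have hterm : ∀ i, pderiv i (fun x => (height x)⁻¹ * (pderiv i f x + x i * fderiv ℝ f x x)) y =
      (height y)⁻¹ * (fderiv ℝ (fderiv ℝ f) y (Pi.single i 1) (Pi.single i 1) + fderiv ℝ f y y
        + y i * pderiv i (fun x => fderiv ℝ f x x) y
        - (height y ^ 2)⁻¹ * (y i * pderiv i f y + y i ^ 2 * fderiv ℝ f y y)) := by
    intro i
    have h := hinv.mul ((differentiableAt_pderiv hf i).hasFDerivAt.add
      ((hasFDerivAt_apply (𝕜 := ℝ) i y).mul hE))
    rw [← pderiv_pderiv hf]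
    refine (congrArg (fun l => l (Pi.single i 1)) h.fderiv).trans ?_
    rw [show pderiv i (fun x => fderiv ℝ f x x) y = _ from
      congrArg (fun l => l (Pi.single i 1)) hE.fderiv]
    simp [fderiv_height, pderiv, Pi.single_apply]
    field_simp
    ring
  have hEE : fderiv ℝ (fun x => fderiv ℝ f x x) y y =
      fderiv ℝ (fderiv ℝ f) y y y + fderiv ℝ f y y := by
    rw [hE.fderiv]; simp [add_comm]
  have hs1 : ∑ i, y i * pderiv i f y = fderiv ℝ f y y := sum_smul_pderiv f y y
  have hs2 : ∑ i, y i * pderiv i (fun x => fderiv ℝ f x x) y = _ :=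
    sum_smul_pderiv (fun x => fderiv ℝ f x x) y y
  -- After summation, `E(Ef)` contributes `D²f(y, y) + Ef` and the divergence of `y` contributes `m
  -- Ef`. The derivative of the density gives `-height⁻² (Ef + (height² - 1) Ef) = -Ef`, cancelling
  -- the extra `Ef`.
  unfold laplaceBeltrami
  simp only [hyperbolicMetric_inv hε, sqrt_abs_det_hyperbolicMetric hε, hsum, hterm]
  rw [← Finset.mul_sum]
  simp only [Finset.sum_add_distrib, Finset.sum_sub_distrib, ← Finset.mul_sum, ← Finset.sum_mul]
  rw [hs1, hs2, hEE, show ∑ i, y i ^ 2 = height y ^ 2 - 1 by rw [height_sq]; ring]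
  simp
  field_simp
  ring

theorem sheet_mem_hyperbolicSpace {ε : ℝ} (hε : ε ^ 2 = 1) (y : Fin m → ℝ) :
    sheet ε y ∈ hyperbolicSpace m := by
  have h := height_sq y
  simp only [hyperbolicSpace, Set.mem_ofPred_eq, lorentz, sheet_eq, Fin.snoc_last,
    Fin.snoc_castSucc, ← sq, mul_pow, hε, h]
  ring

/-- On functions which are constant along rays, the Laplace-Beltrami operator of hyperbolic space
is the restriction of the wave operator of Minkowski space. -/
theorem laplaceBeltrami_comp_sheet {ε : ℝ} (hε : ε ^ 2 = 1) {f : (Fin (m + 1) → ℝ) → ℝ}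
    {y : Fin m → ℝ} (hf : ContDiffAt ℝ 2 f (sheet ε y))
    (h : ∀ᶠ x in 𝓝 (sheet ε y), ∀ᶠ r : ℝ in 𝓝 1, f (r • x) = f x) :
    laplaceBeltrami (hyperbolicMetric m ε) (f ∘ sheet ε) y =
      laplaceBeltrami (minkowskiMetric m) f (sheet ε y) := by
  have hh := (height_pos y).ne'
  have hs : ContDiffAt ℝ 2 (sheet ε) y := (contDiff_sheet ε).contDiffAt
  rw [laplaceBeltrami_hyperbolicMetric hε (hf.comp y hs), laplaceBeltrami_minkowskiMetric hf]
  simp only [fderiv_fderiv_comp hf hs]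
  rw [fderiv_comp y (hf.differentiableAt (by norm_num)) (hs.differentiableAt (by norm_num))]
  have h1 := fderiv_self_of_eventually_smul_eq (hf.differentiableAt (by norm_num)) h.self_of_nhds
  have h2 := fderiv_fderiv_self_of_eventually_smul_eq hf h
  have hsymm : IsSymmSndFDerivAt ℝ f (sheet ε y) := hf.isSymmSndFDerivAt (by simp)
  set x := sheet ε y with hx
  set D := fderiv ℝ f x
  set B := fderiv ℝ (fderiv ℝ f) x with hB
  set e : Fin (m + 1) → ℝ := Pi.single (Fin.last m) 1 with he
  set c := ε * (height y)⁻¹ with hc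
  have hsnoc : ∀ (v : Fin m → ℝ) (t : ℝ), (Fin.snoc (α := fun _ => ℝ) v t : Fin (m + 1) → ℝ) =
      tangentLift 0 v + t • e := by
    intro v t
    rw [tangentLift_apply]
    ext i
    refine Fin.lastCases ?_ (fun i => ?_) i <;> simp [he]
  have hsingle : ∀ i : Fin m, tangentLift 0 (Pi.single i (1 : ℝ)) =
      (Pi.single i.castSucc 1 : Fin (m + 1) → ℝ) := by
    intro i
    rw [tangentLift_apply]
    ext j
    refine Fin.lastCases ?_ (fun j => ?_) j <;> simp [Pi.single_apply]
  have hsq : ∑ k, y k * y k = height y ^ 2 - 1 := by rw [height_sq]; simp [sq]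
  have hc2 : c * (height y ^ 2 * c) = 1 := by rw [hc]; field_simp; exact hε
  have hεc : ε * height y = height y ^ 2 * c := by rw [hc]; field_simp
  -- Tangent vectors are rewritten through the position vector `x` and the timelike vector `e`,
  -- because `D x` and `B x x` vanish by ray invariance.
  have hxe : tangentLift 0 y = x - (height y ^ 2 * c) • e := by
    rw [hx, sheet_eq, hsnoc, ← hεc]; simp
  have hdy : fderiv ℝ (sheet ε) y y = x - c • e := by
    rw [fderiv_sheet, hsnoc, hxe, hsq,
      show ε * ((height y)⁻¹ * (height y ^ 2 - 1)) = height y ^ 2 * c - c by rw [hc]; ring]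
    module
  have hdi : ∀ i, fderiv ℝ (sheet ε) y (Pi.single i 1) =
      Pi.single i.castSucc 1 + (c * y i) • e := by
    intro i
    rw [fderiv_sheet, hsnoc, hsingle]
    simp [hc, Pi.single_apply, mul_assoc]
  have hddy : fderiv ℝ (fderiv ℝ (sheet ε)) y y y = (c * (1 - (height y ^ 2)⁻¹)) • e := by
    rw [fderiv_fderiv_sheet, hsq, hc]
    congr 1
    field_simp
    ring
  have hddi : ∀ i, fderiv ℝ (fderiv ℝ (sheet ε)) y (Pi.single i 1) (Pi.single i 1) =
      (c * (1 - (height y ^ 2)⁻¹ * (y i * y i))) • e := by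
    intro i
    rw [fderiv_fderiv_sheet, hc]
    congr 1
    simp [Pi.single_apply]
    field_simp
  have hBe : B e x = B x e := hsymm.eq e x
  have hBi : ∀ i : Fin m, B e (Pi.single i.castSucc 1) = B (Pi.single i.castSucc 1) e :=
    fun i => hsymm.eq e _
  have hBsum : ∑ i, y i * B (Pi.single i.castSucc 1) e = B x e - height y ^ 2 * c * B e e := by
    have : tangentLift 0 y = ∑ i, y i • (Pi.single i.castSucc 1 : Fin (m + 1) → ℝ) := by
      conv_lhs => rw [pi_eq_sum_univ' y]
      simp [hsingle]
    have h3 := congrArg (fun v => B v e) (this.symm.trans hxe)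
    simpa using h3
  simp only [ContinuousLinearMap.comp_apply, hdy, hdi, hddy, hddi, map_add, map_sub, map_smul,
    add_apply, sub_apply, smul_apply, smul_eq_mul, h1, h2, hBe, hBi]
  rw [Fin.sum_univ_castSucc]
  simp only [lorentzSign_last, lorentzSign_castSucc, ← he, one_mul]
  have hsum : ∀ i : Fin m, B (Pi.single i.castSucc 1) (Pi.single i.castSucc 1) +
      c * y i * B (Pi.single i.castSucc 1) e +
      c * y i * (B (Pi.single i.castSucc 1) e + c * y i * B e e) +
      c * (1 - (height y ^ 2)⁻¹ * (y i * y i)) * D e =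
      B (Pi.single i.castSucc 1) (Pi.single i.castSucc 1) +
      2 * c * (y i * B (Pi.single i.castSucc 1) e) + c ^ 2 * B e e * (y i * y i) + c * D e
      - c * (height y ^ 2)⁻¹ * D e * (y i * y i) := fun i => by ring
  have hi : (height y ^ 2)⁻¹ * height y ^ 2 = 1 := inv_mul_cancel₀ (pow_ne_zero 2 hh)
  simp only [hsum, Finset.sum_add_distrib, Finset.sum_sub_distrib, ← Finset.mul_sum, hBsum, hsq]
  simp only [Finset.sum_const, Finset.card_univ, Fintype.card_fin, nsmul_eq_mul]
  -- The terms in `B x e` have already cancelled and those in `D e` cancel here. As `c² height² =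
  -- 1`, what remains of `B e e` is the timelike term `-B e e` of the wave operator.
  linear_combination (-B e e) * hc2 - c * D e * hi

end Hyperbolic

/-! ### Isotropic coordinates -/

/-- The derivative is the linear coefficient of the expansion along a line; this serves for `quad`,
for `isotropicCoord` and for the derivative of the latter. -/
theorem fderiv_apply_of_quadratic {E F : Type*} [NormedAddCommGroup E] [NormedSpace ℝ E]
    [NormedAddCommGroup F] [NormedSpace ℝ F] {f : E → F} {x v : E} {A B : F}
    (hf : DifferentiableAt ℝ f x) (h : ∀ t : ℝ, f (x + t • v) = f x + t • A + t ^ 2 • B) :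
    fderiv ℝ f x v = A := by
  rw [← hf.lineDeriv_eq_fderiv, lineDeriv]
  simp only [h]
  have h1 : HasDerivAt (fun t : ℝ => f x + t • A + t ^ 2 • B)
      ((1 : ℝ) • A + (2 * (0 : ℝ)) • B) 0 := by
    have := ((hasDerivAt_id (0 : ℝ)).smul_const A).const_add (f x)
    refine this.add (HasDerivAt.smul_const ?_ B)
    simpa using hasDerivAt_pow 2 (0 : ℝ)
  simpa using h1.deriv

/-- The polarization of the quadratic form `quad`. -/
def quadPolar (a₁ a₂ b₁ b₂ b₃ : ℂ) (v w : Fin 3 → ℝ) : ℂ :=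
  2 * a₁ * (v 0 * w 0 - v 1 * w 1) + 2 * a₂ * (v 1 * w 1 - v 2 * w 2)
    + b₁ * (v 0 * w 1 + v 1 * w 0) + b₂ * (v 0 * w 2 + v 2 * w 0) + b₃ * (v 1 * w 2 + v 2 * w 1)

theorem contDiff_ofReal_apply {ι : Type*} [Fintype ι] {k : WithTop ℕ∞} (i : ι) :
    ContDiff ℝ k fun x : ι → ℝ => (x i : ℂ) :=
  Complex.ofRealCLM.contDiff.comp (contDiff_apply ℝ ℝ i)

section

variable (a₁ a₂ b₁ b₂ b₃ : ℂ)

theorem contDiff_quad {k : WithTop ℕ∞} : ContDiff ℝ k (quad a₁ a₂ b₁ b₂ b₃) := by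
  have h := fun i : Fin 3 => contDiff_ofReal_apply (k := k) i
  unfold quad
  exact ((((contDiff_const.mul (((h 0).pow 2).sub ((h 1).pow 2))).add
    (contDiff_const.mul (((h 1).pow 2).sub ((h 2).pow 2)))).add
    (contDiff_const.mul ((h 0).mul (h 1)))).add (contDiff_const.mul ((h 0).mul (h 2)))).add
    (contDiff_const.mul ((h 1).mul (h 2)))

theorem quad_add_smul (x v : Fin 3 → ℝ) (t : ℝ) :
    quad a₁ a₂ b₁ b₂ b₃ (x + t • v) = quad a₁ a₂ b₁ b₂ b₃ x + t • quadPolar a₁ a₂ b₁ b₂ b₃ x v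
      + t ^ 2 • quad a₁ a₂ b₁ b₂ b₃ v := by
  simp [quad, quadPolar]
  ring

theorem quadPolar_add_smul_left (x v w : Fin 3 → ℝ) (t : ℝ) :
    quadPolar a₁ a₂ b₁ b₂ b₃ (x + t • v) w =
      quadPolar a₁ a₂ b₁ b₂ b₃ x w + t • quadPolar a₁ a₂ b₁ b₂ b₃ v w := by
  simp [quadPolar]
  ring

theorem quad_smul (r : ℝ) (x : Fin 3 → ℝ) :
    quad a₁ a₂ b₁ b₂ b₃ (r • x) = (r : ℂ) ^ 2 * quad a₁ a₂ b₁ b₂ b₃ x := by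
  simp [quad]
  ring

theorem pderiv_quad (i : Fin 3) (x : Fin 3 → ℝ) :
    pderiv i (quad a₁ a₂ b₁ b₂ b₃) x = quadPolar a₁ a₂ b₁ b₂ b₃ x (Pi.single i 1) :=
  fderiv_apply_of_quadratic
    ((contDiff_quad a₁ a₂ b₁ b₂ b₃ (k := 1)).differentiable (by simp)).differentiableAt
    (quad_add_smul a₁ a₂ b₁ b₂ b₃ x (Pi.single i 1))

theorem kappa_quad (x : Fin 3 → ℝ) :
    kappa (quad a₁ a₂ b₁ b₂ b₃) (quad a₁ a₂ b₁ b₂ b₃) x =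
      (2 * a₁ * x 0 + b₁ * x 1 + b₂ * x 2) ^ 2 + (b₁ * x 0 + 2 * (a₂ - a₁) * x 1 + b₃ * x 2) ^ 2
        + (b₂ * x 0 + b₃ * x 1 - 2 * a₂ * x 2) ^ 2 := by
  simp [kappa, pderiv_quad, Fin.sum_univ_three, quadPolar, Pi.single_apply]
  ring

theorem kappa_quad_eq_zero_iff :
    (∀ x, kappa (quad a₁ a₂ b₁ b₂ b₃) (quad a₁ a₂ b₁ b₂ b₃) x = 0) ↔
      4 * a₁ ^ 2 + b₁ ^ 2 + b₂ ^ 2 = 0 ∧ 4 * a₁ * a₂ = -b₂ ^ 2 ∧ 2 * a₁ * b₃ = b₁ * b₂ ∧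
        4 * a₂ ^ 2 + b₂ ^ 2 + b₃ ^ 2 = 0 := by
  simp only [kappa_quad]
  constructor
  · intro h
    -- Polarization: these four values already determine the four relations.
    have h0 := h ![1, 0, 0]
    have h1 := h ![0, 1, 0]
    have h2 := h ![0, 0, 1]
    have h12 := h ![0, 1, 1]
    simp at h0 h1 h2 h12
    refine ⟨by linear_combination h0, by linear_combination (h0 + h2 - h1) / 2,
      by linear_combination (h1 + h2 - h12) / 2, by linear_combination h2⟩
  · rintro ⟨e1, e2, e3, e4⟩ x
    -- The coefficients of `x 0 * x 1` and `x 0 * x 2` are not among the four relations. They vanish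
    -- after multiplication by `2 * a₁`; if `a₁ = 0`, the relations force `b₁ = b₂ = 0`.
    have h01 : 2 * a₂ * b₁ + b₂ * b₃ = 0 ∧ 2 * a₁ * b₂ + b₁ * b₃ - 2 * a₂ * b₂ = 0 := by
      rcases eq_or_ne a₁ 0 with rfl | ha
      · have hb2 : b₂ = 0 := by simpa using e2
        have hb1 : b₁ = 0 := by simpa [hb2] using e1
        simp [hb1, hb2]
      · constructor <;> refine (mul_eq_zero.1 (?_ : 2 * a₁ * _ = 0)).resolve_left (by simpa)
        · linear_combination b₁ * e2 + b₂ * e3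
        · linear_combination b₂ * e1 + b₁ * e3 - b₂ * e2
    obtain ⟨e5, e6⟩ := h01
    linear_combination x 0 ^ 2 * e1 + x 1 ^ 2 * (e1 + e4 - 2 * e2) + x 2 ^ 2 * e4
      + 2 * x 0 * x 1 * e5 + 2 * x 0 * x 2 * e6 - 2 * x 1 * x 2 * e3

variable {n : ℕ}

/-- The coordinates `(p, z)` through which `phiHat` factors. -/
def isotropicCoord (x : Fin (2 * n + 2 + 1) → ℝ) : ℂ × (Fin n → ℂ) :=
  (quad a₁ a₂ b₁ b₂ b₃ (firstThree x), zCoord x)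

theorem firstThree_add_smul (x v : Fin (2 * n + 2 + 1) → ℝ) (t : ℝ) :
    firstThree (x + t • v) = firstThree x + t • firstThree v := rfl

theorem zCoord_add_smul (x v : Fin (2 * n + 2 + 1) → ℝ) (t : ℝ) :
    zCoord (n := n) (x + t • v) = zCoord x + t • zCoord v := by
  ext k
  simp only [zCoord, Pi.add_apply, Pi.smul_apply]
  split_ifs <;> simp <;> ring

theorem zCoord_smul (r : ℝ) (x : Fin (2 * n + 2 + 1) → ℝ) :
    zCoord (n := n) (r • x) = (r : ℂ) • zCoord x := by
  ext k
  simp only [zCoord, Pi.smul_apply]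
  split_ifs <;> simp <;> ring

theorem contDiff_zCoord {k : WithTop ℕ∞} : ContDiff ℝ k (zCoord (n := n)) := by
  have h := fun i : Fin (2 * n + 2 + 1) => contDiff_ofReal_apply (k := k) i
  refine contDiff_pi.2 fun i => ?_
  unfold zCoord
  split_ifs
  · exact (h _).add (contDiff_const.mul (h _))
  · exact (h _).sub (h _)

theorem contDiff_isotropicCoord {k : WithTop ℕ∞} :
    ContDiff ℝ k (isotropicCoord a₁ a₂ b₁ b₂ b₃ (n := n)) :=
  ((contDiff_quad a₁ a₂ b₁ b₂ b₃).comp (contDiff_pi.2 fun _ => contDiff_apply ℝ ℝ _)).prodMk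
    contDiff_zCoord

theorem fderiv_isotropicCoord (x v : Fin (2 * n + 2 + 1) → ℝ) :
    fderiv ℝ (isotropicCoord a₁ a₂ b₁ b₂ b₃) x v =
      (quadPolar a₁ a₂ b₁ b₂ b₃ (firstThree x) (firstThree v), zCoord v) := by
  refine fderiv_apply_of_quadratic (B := (quad a₁ a₂ b₁ b₂ b₃ (firstThree v), 0))
    ((contDiff_isotropicCoord a₁ a₂ b₁ b₂ b₃ (k := 1)).differentiable (by simp)).differentiableAt
    fun t => ?_
  simp only [isotropicCoord, firstThree_add_smul, quad_add_smul, zCoord_add_smul]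
  simp

theorem fderiv_fderiv_isotropicCoord (x v w : Fin (2 * n + 2 + 1) → ℝ) :
    fderiv ℝ (fderiv ℝ (isotropicCoord a₁ a₂ b₁ b₂ b₃)) x v w =
      (quadPolar a₁ a₂ b₁ b₂ b₃ (firstThree v) (firstThree w), 0) := by
  have hc := fun y => (contDiff_isotropicCoord a₁ a₂ b₁ b₂ b₃ (k := 2) (n := n)).contDiffAt (x := y)
  rw [← fderiv_fderiv_apply (hc x)]
  refine fderiv_apply_of_quadratic (B := 0)
    ((differentiableAt_fderiv_of_contDiffAt_two (hc x)).clm_apply (differentiableAt_const _))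
    fun t => ?_
  simp [fderiv_isotropicCoord, firstThree_add_smul, quadPolar_add_smul_left]

end

/-! ### The standard basis in the coordinates `(p, z)` -/

theorem sum_fin_split {M : Type*} [AddCommMonoid M] (n : ℕ) (a : Fin (2 * n + 2 + 1) → M) :
    ∑ i, a i = ∑ i : Fin 3, a ⟨i, by omega⟩ +
      ∑ k : Fin n, (a ⟨2 * k + 3, by omega⟩ + a ⟨2 * k + 4, by omega⟩) := by
  -- The induction runs over sequences on `ℕ`, since the index type of `a` itself depends on `n`.
  have key : ∀ (b : ℕ → M) (n : ℕ), ∑ i ∈ Finset.range (2 * n + 2 + 1), b i =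
      ∑ i ∈ Finset.range 3, b i + ∑ k ∈ Finset.range n, (b (2 * k + 3) + b (2 * k + 4)) := by
    intro b n
    induction n with
    | zero => simp
    | succ n ih =>
      rw [Finset.sum_range_succ _ n, ← add_assoc, ← ih,
        show 2 * (n + 1) + 2 + 1 = 2 * n + 2 + 1 + 1 + 1 by ring, Finset.sum_range_succ,
        Finset.sum_range_succ, add_assoc]
  have h := key (fun i => if h : i < 2 * n + 2 + 1 then a ⟨i, h⟩ else 0) n
  rw [← Fin.sum_univ_eq_sum_range, ← Fin.sum_univ_eq_sum_range, ← Fin.sum_univ_eq_sum_range] at h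
  convert h using 2
  · rw [dif_pos (Fin.isLt _)]
  · refine Finset.sum_congr rfl fun i _ => ?_
    rw [dif_pos (by omega)]
  · refine Finset.sum_congr rfl fun i _ => ?_
    rw [dif_pos (by omega), dif_pos (by omega)]

/-- The second coefficient of the `k`-th complex coordinate. -/
def zCoeff {n : ℕ} (k : Fin n) : ℂ := if (k : ℕ) + 1 < n then Complex.I else -1

section Basis

variable {n : ℕ}

theorem firstThree_single_low (i : Fin 3) :
    firstThree (n := n) (Pi.single ⟨i, by omega⟩ 1) = Pi.single i 1 := by
  ext j
  simp [firstThree, Pi.single_apply, Fin.ext_iff]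

theorem firstThree_single_high (j : ℕ) (hj : j + 3 < 2 * n + 2 + 1) :
    firstThree (n := n) (Pi.single ⟨j + 3, hj⟩ 1) = 0 := by
  ext i
  have : (i : ℕ) ≠ j + 3 := by omega
  simp [firstThree, this]

theorem zCoord_single_low (i : Fin 3) :
    zCoord (n := n) (Pi.single ⟨i, by omega⟩ 1) = 0 := by
  ext k
  have h1 : 2 * (k : ℕ) + 3 ≠ i := by omega
  have h2 : 2 * (k : ℕ) + 4 ≠ i := by omega
  simp [zCoord, h1, h2]

theorem zCoord_single_odd (k : Fin n) :
    zCoord (n := n) (Pi.single ⟨2 * k + 3, by omega⟩ 1) = Pi.single k 1 := by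
  ext l
  have h2 : 2 * (l : ℕ) + 4 ≠ 2 * k + 3 := by omega
  by_cases h : l = k
  · subst h
    simp [zCoord]
  · have h3 : (l : ℕ) ≠ k := fun h' => h (Fin.ext h')
    simp [zCoord, h, h3, h2]

theorem zCoord_single_even (k : Fin n) :
    zCoord (n := n) (Pi.single ⟨2 * k + 4, by omega⟩ 1) = zCoeff k • Pi.single k 1 := by
  ext l
  have h2 : 2 * (l : ℕ) + 3 ≠ 2 * k + 4 := by omega
  by_cases h : l = k
  · subst h
    simp [zCoord, zCoeff]
  · have h3 : (l : ℕ) ≠ k := fun h' => h (Fin.ext h')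
    have h4 : ¬2 * (l : ℕ) = 2 * k + 1 := by omega
    simp [zCoord, h, h3, h4]

theorem lorentzSign_of_lt {m : ℕ} (i : Fin (m + 1)) (h : (i : ℕ) < m) : lorentzSign m i = 1 :=
  lorentzSign_castSucc ⟨i, h⟩

/-- This is the nullity of the gradient of `z_k`. The index `2 * k + 4` is the timelike one exactly
when `k` is the last index, where the coefficient changes from `i` to `-1`. -/
theorem one_add_lorentzSign_mul_zCoeff_sq (k : Fin n) :
    1 + (lorentzSign (2 * n + 2) ⟨2 * k + 4, by omega⟩ : ℂ) * zCoeff k ^ 2 = 0 := by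
  unfold zCoeff
  split_ifs with h
  · rw [lorentzSign_of_lt _ (by simp; omega)]; simp
  · rw [show (⟨2 * k + 4, by omega⟩ : Fin (2 * n + 2 + 1)) = Fin.last _ from
      Fin.ext (by simp; omega)]
    simp

end Basis

/-! ### The wave operator on holomorphic functions of `(p, z)` -/

section Wave

variable {E : Type*} [NormedAddCommGroup E] [NormedSpace ℂ E]

theorem fderiv_re_of_differentiableAt {K : E → ℂ} {x : E} (hK : DifferentiableAt ℂ K x) (v : E) :
    fderiv ℝ (fun y => (K y).re) x v = (fderiv ℂ K x v).re := by
  have h : HasFDerivAt (fun y => (K y).re) _ x :=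
    Complex.reCLM.hasFDerivAt.comp x (hK.hasFDerivAt.restrictScalars ℝ)
  rw [h.fderiv]; rfl

/-- Passing to the complex Hessian makes it complex bilinear, so the complex derivatives of `p` and
`z` can be pulled out as scalars. -/
theorem fderiv_fderiv_re_of_contDiffAt {K : E → ℂ} {x : E} (hK : ContDiffAt ℂ 2 K x) (v w : E) :
    fderiv ℝ (fderiv ℝ fun y => (K y).re) x v w = (fderiv ℂ (fderiv ℂ K) x v w).re := by
  have hR : ContDiffAt ℝ 2 (fun y => (K y).re) x :=
    Complex.reCLM.contDiff.contDiffAt.comp x (hK.restrict_scalars ℝ)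
  have hD : DifferentiableAt ℂ (fderiv ℂ K) x :=
    (hK.fderiv_right (m := 1) (by norm_num)).differentiableAt (by norm_num)
  rw [← fderiv_fderiv_apply hR]
  have h : (fun y => fderiv ℝ (fun y => (K y).re) y w) =ᶠ[𝓝 x] fun y => (fderiv ℂ K y w).re :=
    (hK.eventually (by simp)).mono fun y hy =>
      fderiv_re_of_differentiableAt (hy.differentiableAt (by norm_num)) w
  rw [h.fderiv_eq, fderiv_re_of_differentiableAt (hD.clm_apply (differentiableAt_const w)),
    fderiv_clm_apply hD (differentiableAt_const w)]
  simp

end Wave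

variable {a₁ a₂ b₁ b₂ b₃ : ℂ} {n : ℕ}

theorem laplaceBeltrami_congr {m : ℕ} (G : (Fin m → ℝ) → Matrix (Fin m) (Fin m) ℝ)
    {f g : (Fin m → ℝ) → ℝ} {x : Fin m → ℝ} (h : f =ᶠ[𝓝 x] g) :
    laplaceBeltrami G f x = laplaceBeltrami G g x := by
  unfold laplaceBeltrami
  congr 1
  refine Finset.sum_congr rfl fun i _ => ?_
  unfold pderiv
  congr 1
  refine Filter.EventuallyEq.fderiv_eq ?_
  filter_upwards [h.fderiv (𝕜 := ℝ)] with y hy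
  rw [hy]

/-- Real parts of holomorphic functions of the isotropic coordinates are harmonic on Minkowski
space. -/
theorem laplaceBeltrami_re_comp_isotropicCoord
    (hn : 0 < n) (hκ : ∀ x, kappa (quad a₁ a₂ b₁ b₂ b₃) (quad a₁ a₂ b₁ b₂ b₃) x = 0)
    {K : ℂ × (Fin n → ℂ) → ℂ} {x : Fin (2 * n + 2 + 1) → ℝ}
    (hK : ContDiffAt ℂ 2 K (isotropicCoord a₁ a₂ b₁ b₂ b₃ x)) :
    laplaceBeltrami (minkowskiMetric (2 * n + 2))
      ((fun y => (K y).re) ∘ isotropicCoord a₁ a₂ b₁ b₂ b₃) x = 0 := by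
  have hR : ContDiffAt ℝ 2 (fun y => (K y).re) (isotropicCoord a₁ a₂ b₁ b₂ b₃ x) :=
    Complex.reCLM.contDiff.contDiffAt.comp _ (hK.restrict_scalars ℝ)
  have hc := (contDiff_isotropicCoord a₁ a₂ b₁ b₂ b₃ (k := 2) (n := n)).contDiffAt (x := x)
  rw [laplaceBeltrami_minkowskiMetric (hR.comp x hc)]
  simp only [fderiv_fderiv_comp hR hc, fderiv_fderiv_re_of_contDiffAt hK,
    fderiv_re_of_differentiableAt (hK.differentiableAt (by norm_num)), fderiv_isotropicCoord,
    fderiv_fderiv_isotropicCoord, ← Complex.add_re, ← Complex.re_ofReal_mul, ← Complex.re_sum]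
  set D := fderiv ℂ K (isotropicCoord a₁ a₂ b₁ b₂ b₃ x)
  set B := fderiv ℂ (fderiv ℂ K) (isotropicCoord a₁ a₂ b₁ b₂ b₃ x)
  have hfst : ∀ c : ℂ, ((c, 0) : ℂ × (Fin n → ℂ)) = c • ((1, 0) : ℂ × (Fin n → ℂ)) := by simp
  have hsnd : ∀ (c : ℂ) (v : Fin n → ℂ), ((0, c • v) : ℂ × (Fin n → ℂ)) = c • (0, v) := by simp
  have hp0 : ∀ v, quadPolar a₁ a₂ b₁ b₂ b₃ v 0 = 0 := by simp [quadPolar]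
  rw [sum_fin_split, show (0 : ℝ) = (0 + 0 : ℂ).re by simp]
  congr 2
  -- The first three directions move only `p`. They give `κ(p, p)` times a second derivative of `K`,
  -- plus a first derivative times the trace `2a₁ + 2(a₂ - a₁) - 2a₂ = 0`.
  · have hk := hκ (firstThree x)
    simp only [kappa, pderiv_quad] at hk
    have hl : ∀ i : Fin 3, lorentzSign (2 * n + 2) ⟨i, by omega⟩ = 1 :=
      fun i => lorentzSign_of_lt _ (by simp; omega)
    simp only [hl, firstThree_single_low, zCoord_single_low, hfst (quadPolar _ _ _ _ _ _ _),
      map_smul, smul_apply, smul_eq_mul, Complex.ofReal_one, one_mul,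
      Finset.sum_add_distrib, ← mul_assoc, ← Finset.sum_mul, hk]
    simp [Fin.sum_univ_three, quadPolar]
  -- Each remaining pair moves only one `z_k`, and linearly, so only the pure second derivative in
  -- `z_k` survives.
  · refine Finset.sum_eq_zero fun k _ => ?_
    have h3 := firstThree_single_high (n := n) (2 * k) (by omega)
    have h4 := firstThree_single_high (n := n) (2 * k + 1) (by omega)
    have hl := lorentzSign_of_lt (m := 2 * n + 2) ⟨2 * k + 3, by omega⟩ (by simp; omega)
    simp only [h3, h4, hp0, zCoord_single_odd, zCoord_single_even, hsnd, hl,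
      map_smul, smul_apply, smul_eq_mul, Complex.ofReal_one, one_mul, Prod.mk_zero_zero, map_zero,
      add_zero]
    linear_combination B (0, Pi.single k 1) (0, Pi.single k 1) * one_add_lorentzSign_mul_zCoeff_sq k

/-- Holomorphic functions of the isotropic coordinates are harmonic morphisms. -/
theorem isHarmonicMorphismOn_comp_isotropicCoord
    (hn : 0 < n) (hκ : ∀ x, kappa (quad a₁ a₂ b₁ b₂ b₃) (quad a₁ a₂ b₁ b₂ b₃) x = 0)
    {G : ℂ × (Fin n → ℂ) → ℂ} {Ω : Set (Fin (2 * n + 2 + 1) → ℝ)} (hΩ : IsOpen Ω)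
    (hG : ∀ x ∈ Ω, AnalyticAt ℂ G (isotropicCoord a₁ a₂ b₁ b₂ b₃ x)) :
    IsHarmonicMorphismOn (minkowskiMetric (2 * n + 2)) (G ∘ isotropicCoord a₁ a₂ b₁ b₂ b₃) Ω := by
  have hφ : ∀ x ∈ Ω, ∀ k : WithTop ℕ∞, ContDiffAt ℝ k (G ∘ isotropicCoord a₁ a₂ b₁ b₂ b₃) x :=
    fun x hx k => ((hG x hx).contDiffAt.restrict_scalars ℝ).comp x
      (contDiff_isotropicCoord a₁ a₂ b₁ b₂ b₃).contDiffAt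
  refine ⟨hΩ, fun x hx => (hφ x hx _).contDiffWithinAt, fun W f hW _ hf => ⟨?_, ?_⟩⟩
  · exact fun x hx => ((hf _ hx.2).1.comp x (hφ x hx.1 2)).contDiffWithinAt
  · rintro x ⟨hx, hxW⟩
    -- A holomorphic function with real part `f` is available on a disc, which suffices because the
    -- Laplacian is local.
    obtain ⟨R, hR, hball⟩ := Metric.isOpen_iff.1 hW _ hxW
    obtain ⟨g, hg, hgf⟩ := (hf.mono hball).exists_analyticOnNhd_ball_re_eq
    have hev : f ∘ (G ∘ isotropicCoord a₁ a₂ b₁ b₂ b₃) =ᶠ[𝓝 x]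
        (fun y => ((g ∘ G) y).re) ∘ isotropicCoord a₁ a₂ b₁ b₂ b₃ := by
      filter_upwards [(hφ x hx 2).continuousAt (Metric.ball_mem_nhds _ hR)] with y hy
      exact (hgf hy).symm
    rw [laplaceBeltrami_congr _ hev]
    refine laplaceBeltrami_re_comp_isotropicCoord hn hκ (AnalyticAt.contDiffAt ?_)
    have hgx : AnalyticAt ℂ g (G (isotropicCoord a₁ a₂ b₁ b₂ b₃ x)) :=
      hg _ (Metric.mem_ball_self hR)
    exact hgx.comp (hG x hx)

/-! ### Holomorphy of the quotient and openness of its domain -/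

theorem analyticAt_eval_mvPolynomial (P : MvPolynomial (Fin n) ℂ) (y : ℂ × (Fin n → ℂ)) :
    AnalyticAt ℂ (fun y : ℂ × (Fin n → ℂ) => MvPolynomial.eval y.2 P) y := by
  refine AnalyticAt.aeval_mvPolynomial (f := fun y : ℂ × (Fin n → ℂ) => y.2) (fun i => ?_) P
  exact (((ContinuousLinearMap.proj i).comp
    (ContinuousLinearMap.snd ℂ ℂ (Fin n → ℂ))) : _ →L[ℂ] ℂ).analyticAt y

theorem cpow_half_of_even {d : ℕ} (hd : Even d) (w : ℂ) : w ^ ((d : ℂ) / 2) = w ^ (d / 2) := by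
  obtain ⟨k, rfl⟩ := hd
  rw [← Complex.cpow_natCast]
  congr 1
  rw [← two_mul, Nat.mul_div_cancel_left k two_pos]
  push_cast
  ring

/-- For even `d` the power is a polynomial, so the branch cut matters only for odd `d`. -/
theorem analyticAt_cpow_half {d : ℕ} {y : ℂ × (Fin n → ℂ)}
    (hy : Odd d → y.1 ∈ Complex.slitPlane) :
    AnalyticAt ℂ (fun y : ℂ × (Fin n → ℂ) => y.1 ^ ((d : ℂ) / 2)) y := by
  rcases Nat.even_or_odd d with hd | hd
  · simp only [cpow_half_of_even hd]
    exact analyticAt_fst.pow _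
  · exact analyticAt_fst.cpow analyticAt_const (hy hd)

theorem isOpen_timelikeCone (m : ℕ) : IsOpen (timelikeCone m) := by
  refine isOpen_lt ?_ continuous_const
  unfold lorentz
  fun_prop

theorem isOpen_phiHatDomain (d : ℕ) (Q : MvPolynomial (Fin n) ℂ) :
    IsOpen (phiHatDomain d (quad a₁ a₂ b₁ b₂ b₃) Q) := by
  refine (isOpen_timelikeCone _).inter (IsOpen.inter ?_ ?_)
  · exact isOpen_ne_fun
      ((MvPolynomial.continuous_eval Q).comp (contDiff_zCoord (k := 0)).continuous) continuous_const
  · by_cases hd : Odd d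
    · simp only [hd, true_imp_iff]
      exact Complex.isOpen_slitPlane.preimage
        (continuous_fst.comp (contDiff_isotropicCoord a₁ a₂ b₁ b₂ b₃ (k := 0)).continuous)
    · simp only [hd, false_imp_iff]
      exact isOpen_univ

theorem isHarmonicMorphismOn_phiHat (hn : 0 < n)
    (hκ : ∀ x, kappa (quad a₁ a₂ b₁ b₂ b₃) (quad a₁ a₂ b₁ b₂ b₃) x = 0) (d : ℕ)
    (P Q : MvPolynomial (Fin n) ℂ) :
    IsHarmonicMorphismOn (minkowskiMetric (2 * n + 2))
      (phiHat d (quad a₁ a₂ b₁ b₂ b₃) P Q) (phiHatDomain d (quad a₁ a₂ b₁ b₂ b₃) Q) := by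
  refine isHarmonicMorphismOn_comp_isotropicCoord hn hκ
    (G := fun y => (y.1 ^ ((d : ℂ) / 2) + MvPolynomial.eval y.2 P) / MvPolynomial.eval y.2 Q)
    (isOpen_phiHatDomain d Q) fun x hx => ?_
  exact ((analyticAt_cpow_half hx.2.2).add (analyticAt_eval_mvPolynomial P _)).div
    (analyticAt_eval_mvPolynomial Q _) hx.2.1

/-! ### Invariance under positive homotheties -/

theorem lorentz_smul {m : ℕ} (r : ℝ) (x : Fin (m + 1) → ℝ) :
    lorentz (r • x) (r • x) = r ^ 2 * lorentz x x := by
  simp only [lorentz, Pi.smul_apply, smul_eq_mul, mul_add, Finset.mul_sum]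
  congr 1
  · ring
  · exact Finset.sum_congr rfl fun k _ => by ring

theorem eval_smul_of_isHomogeneous {σ R : Type*} [CommSemiring R] {P : MvPolynomial σ R} {d : ℕ}
    (hP : P.IsHomogeneous d) (r : R) (z : σ → R) :
    MvPolynomial.eval (r • z) P = r ^ d * MvPolynomial.eval z P := by
  rw [MvPolynomial.eval_eq, MvPolynomial.eval_eq, Finset.mul_sum]
  refine Finset.sum_congr rfl fun s hs => ?_
  have h : ∑ i ∈ s.support, s i = d := hP.degree_eq_sum_deg_support hs |>.symm
  simp only [Pi.smul_apply, smul_eq_mul, mul_pow, Finset.prod_mul_distrib,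
    Finset.prod_pow_eq_pow_sum, h]
  ring

/-- A positive factor adds a real number to the principal logarithm, so no branch is crossed, even
for `w` on the cut. At `w = 0` both sides vanish because `d > 0`. -/
theorem cpow_half_smul {d : ℕ} (hd : 0 < d) {r : ℝ} (hr : 0 < r) (w : ℂ) :
    ((r : ℂ) ^ 2 * w) ^ ((d : ℂ) / 2) = (r : ℂ) ^ d * w ^ ((d : ℂ) / 2) := by
  have hd' : (d : ℂ) / 2 ≠ 0 := by simpa using hd.ne'
  have hr' : (r : ℂ) ≠ 0 := by exact_mod_cast hr.ne'
  rcases eq_or_ne w 0 with rfl | hw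
  · simp [Complex.zero_cpow hd']
  rw [Complex.cpow_def_of_ne_zero (by simp [hr', hw]), Complex.cpow_def_of_ne_zero hw,
    ← Complex.ofReal_pow, Complex.log_ofReal_mul (by positivity) hw, add_mul, Complex.exp_add]
  congr 1
  rw [Real.log_pow, ← Complex.exp_log (pow_ne_zero d hr'), ← Complex.ofReal_pow,
    ← Complex.ofReal_log (by positivity), Real.log_pow]
  congr 1
  push_cast
  ring

variable {d : ℕ} {P Q : MvPolynomial (Fin n) ℂ}

theorem smul_mem_phiHatDomain (hQ : Q.IsHomogeneous d) {x : Fin (2 * n + 2 + 1) → ℝ}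
    (hx : x ∈ phiHatDomain d (quad a₁ a₂ b₁ b₂ b₃) Q) {r : ℝ} (hr : 0 < r) :
    r • x ∈ phiHatDomain d (quad a₁ a₂ b₁ b₂ b₃) Q := by
  obtain ⟨h1, h2, h3⟩ := hx
  refine ⟨?_, ?_, fun hd => ?_⟩
  · change lorentz (r • x) (r • x) < 0
    rw [lorentz_smul]
    exact mul_neg_of_pos_of_neg (by positivity) h1
  · rw [zCoord_smul, eval_smul_of_isHomogeneous hQ]
    exact mul_ne_zero (pow_ne_zero _ (by exact_mod_cast hr.ne')) h2
  · have h4 := h3 hd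
    rw [show firstThree (r • x) = r • firstThree x from rfl, quad_smul, ← Complex.ofReal_pow,
      Complex.mem_slitPlane_iff_arg, Complex.arg_real_mul _ (by positivity)]
    rw [Complex.mem_slitPlane_iff_arg] at h4
    exact ⟨h4.1, mul_ne_zero (by exact_mod_cast (pow_pos hr 2).ne') h4.2⟩

theorem phiHat_smul (hd : 0 < d) (hP : P.IsHomogeneous d) (hQ : Q.IsHomogeneous d)
    (x : Fin (2 * n + 2 + 1) → ℝ) {r : ℝ} (hr : 0 < r) :
    phiHat d (quad a₁ a₂ b₁ b₂ b₃) P Q (r • x) = phiHat d (quad a₁ a₂ b₁ b₂ b₃) P Q x := by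
  have hr' : (r : ℂ) ^ d ≠ 0 := pow_ne_zero _ (by exact_mod_cast hr.ne')
  rw [phiHat, show firstThree (r • x) = r • firstThree x from rfl, quad_smul, zCoord_smul,
    eval_smul_of_isHomogeneous hP, eval_smul_of_isHomogeneous hQ, cpow_half_smul hd hr, ← mul_add,
    mul_div_mul_left _ _ hr', phiHat]

/-! ### Descent to hyperbolic space -/

theorem lorentz_radialProj {m : ℕ} {x : Fin (m + 1) → ℝ} (hx : x ∈ timelikeCone m) :
    lorentz (radialProj x) (radialProj x) = -1 := by
  have h : 0 < -lorentz x x := neg_pos.2 hx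
  rw [radialProj, lorentz_smul, inv_pow, Real.sq_sqrt h.le]
  rw [← neg_neg (lorentz x x), mul_neg, neg_neg, inv_mul_cancel₀ h.ne']

theorem radialProj_of_mem_hyperbolicSpace {m : ℕ} {x : Fin (m + 1) → ℝ}
    (hx : x ∈ hyperbolicSpace m) : radialProj x = x := by
  have h : lorentz x x = -1 := hx
  simp [radialProj, h]

/-- The projection rescales by a positive factor, so it stays in the cone `V`, and it fixes
hyperbolic space pointwise. In this form the image is visibly relatively open when `V` is open. -/
theorem image_radialProj {m : ℕ} {V : Set (Fin (m + 1) → ℝ)} (hV : V ⊆ timelikeCone m)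
    (h : ∀ x ∈ V, ∀ r : ℝ, 0 < r → r • x ∈ V) : radialProj '' V = V ∩ hyperbolicSpace m := by
  ext x
  constructor
  · rintro ⟨y, hy, rfl⟩
    have : 0 < -lorentz y y := neg_pos.2 (hV hy)
    exact ⟨h y hy _ (by positivity), lorentz_radialProj (hV hy)⟩
  · exact fun hx => ⟨x, hx.1, radialProj_of_mem_hyperbolicSpace hx.2⟩

/-- A harmonic morphism on a cone in the timelike cone which is constant along rays restricts to a
harmonic morphism on hyperbolic space. -/
theorem isHarmonicMorphismOnHyperbolic_of_minkowski {m : ℕ} {V : Set (Fin (m + 1) → ℝ)}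
    {φ : (Fin (m + 1) → ℝ) → ℂ} (hφ : IsHarmonicMorphismOn (minkowskiMetric m) φ V)
    (h : ∀ x ∈ V, ∀ r : ℝ, 0 < r → φ (r • x) = φ x) :
    IsHarmonicMorphismOnHyperbolic φ (V ∩ hyperbolicSpace m) := by
  obtain ⟨hV, hsmooth, hharm⟩ := hφ
  refine ⟨Set.inter_subset_right, fun ε hε => ?_⟩
  have hε2 : ε ^ 2 = 1 := by rcases hε with rfl | rfl <;> norm_num
  have hpre : sheet ε ⁻¹' (V ∩ hyperbolicSpace m) = sheet ε ⁻¹' V := by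
    ext y
    simp [sheet_mem_hyperbolicSpace hε2 y]
  have hcont : Continuous (sheet (m := m) ε) := (contDiff_sheet (k := 0) ε).continuous
  rw [hpre]
  refine ⟨hV.preimage hcont, hsmooth.comp (contDiff_sheet ε).contDiffOn fun _ hy => hy, ?_⟩
  intro W f hW hne hf
  have hopen : IsOpen (V ∩ φ ⁻¹' W) := hsmooth.continuousOn.isOpen_inter_preimage hV hW
  obtain ⟨y₀, hy₀⟩ := hne
  obtain ⟨h2, hlap⟩ := hharm W f hW ⟨sheet ε y₀, hy₀⟩ hf
  refine ⟨h2.comp (contDiff_sheet ε).contDiffOn fun _ hy => hy, fun y hy => ?_⟩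
  have hy' : sheet ε y ∈ V ∩ φ ⁻¹' W := hy
  have key := laplaceBeltrami_comp_sheet hε2 (h2.contDiffAt (hopen.mem_nhds hy')) (by
    filter_upwards [hopen.mem_nhds hy'] with x hx
    filter_upwards [lt_mem_nhds one_pos] with r hr
    exact congrArg f (h x hx.1 r hr))
  rw [hlap _ hy'] at key
  exact key

/-- If `z_n = 0`, the timelike coordinate equals a spacelike one, whose square then makes `⟨x, x⟩_L
≥ 0`; so `z_n` has no zero in the timelike cone. -/
theorem phiHatDomain_eq_timelikeCone (hn : 0 < n) (hd : Even d) (p : (Fin 3 → ℝ) → ℂ) :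
    phiHatDomain d p (MvPolynomial.X ⟨n - 1, by omega⟩ ^ d : MvPolynomial (Fin n) ℂ) =
      timelikeCone (2 * n + 2) := by
  refine Set.Subset.antisymm (fun x hx => hx.1) fun x hx => ⟨hx, ?_, fun ho => ?_⟩
  · rw [map_pow, MvPolynomial.eval_X]
    refine pow_ne_zero _ fun h0 => ?_
    simp only [zCoord, show ¬(n - 1 + 1 < n) by omega, if_false, sub_eq_zero,
      Complex.ofReal_inj] at h0
    have hx' : lorentz x x < 0 := hx
    have h1 : x ⟨2 * n + 1, by omega⟩ = x (Fin.last (2 * n + 2)) := by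
      convert h0 using 2 <;> ext <;> simp <;> omega
    have h2 := Finset.single_le_sum (f := fun k : Fin (2 * n + 2) => x k.castSucc * x k.castSucc)
      (fun k _ => mul_self_nonneg _) (Finset.mem_univ ⟨2 * n + 1, by omega⟩)
    simp only [Fin.castSucc_mk, h1] at h2
    unfold lorentz at hx'
    linarith
  · exact absurd hd (Nat.not_even_iff_odd.2 ho)

end HarmonicMorphism

end

theorem mainTheorem4 (n d : ℕ) (hn : 0 < n) (hd : 0 < d) (a₁ a₂ b₁ b₂ b₃ : ℂ)
    (P Q : MvPolynomial (Fin n) ℂ) (hP : P.IsHomogeneous d) (hQ : Q.IsHomogeneous d) :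
    ((∀ x, kappa (quad a₁ a₂ b₁ b₂ b₃) (quad a₁ a₂ b₁ b₂ b₃) x = 0) ↔
      4 * a₁ ^ 2 + b₁ ^ 2 + b₂ ^ 2 = 0 ∧ 4 * a₁ * a₂ = -b₂ ^ 2 ∧ 2 * a₁ * b₃ = b₁ * b₂ ∧
        4 * a₂ ^ 2 + b₂ ^ 2 + b₃ ^ 2 = 0) ∧
    ((∀ x, kappa (quad a₁ a₂ b₁ b₂ b₃) (quad a₁ a₂ b₁ b₂ b₃) x = 0) →
      IsHarmonicMorphismOn (minkowskiMetric (2 * n + 2))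
        (phiHat d (quad a₁ a₂ b₁ b₂ b₃) P Q) (phiHatDomain d (quad a₁ a₂ b₁ b₂ b₃) Q) ∧
      (∀ x ∈ phiHatDomain d (quad a₁ a₂ b₁ b₂ b₃) Q, ∀ r : ℝ, 0 < r →
        r • x ∈ phiHatDomain d (quad a₁ a₂ b₁ b₂ b₃) Q ∧
        phiHat d (quad a₁ a₂ b₁ b₂ b₃) P Q (r • x) = phiHat d (quad a₁ a₂ b₁ b₂ b₃) P Q x) ∧
      (∃ Φ : (Fin (2 * n + 2 + 1) → ℝ) → ℂ,
        (∀ x ∈ phiHatDomain d (quad a₁ a₂ b₁ b₂ b₃) Q,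
          Φ (radialProj x) = phiHat d (quad a₁ a₂ b₁ b₂ b₃) P Q x) ∧
        IsHarmonicMorphismOnHyperbolic Φ
          (radialProj '' phiHatDomain d (quad a₁ a₂ b₁ b₂ b₃) Q)) ∧
      (Even d → Q = MvPolynomial.X ⟨n - 1, by omega⟩ ^ d →
        phiHatDomain d (quad a₁ a₂ b₁ b₂ b₃) Q = timelikeCone (2 * n + 2) ∧
        radialProj '' phiHatDomain d (quad a₁ a₂ b₁ b₂ b₃) Q =
          hyperbolicSpace (2 * n + 2))) := by
  refine ⟨kappa_quad_eq_zero_iff a₁ a₂ b₁ b₂ b₃, fun hκ => ?_⟩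
  have hV : phiHatDomain d (quad a₁ a₂ b₁ b₂ b₃) Q ⊆ timelikeCone (2 * n + 2) := fun x hx => hx.1
  have himage := image_radialProj hV fun x hx r hr => smul_mem_phiHatDomain hQ hx hr
  have hφ := isHarmonicMorphismOn_phiHat hn hκ d P Q
  -- The witness for `Φ` is `phiHat` itself: `radialProj` is a positive rescaling, under which
  -- `phiHat` is invariant.
  refine ⟨hφ, fun x hx r hr => ⟨smul_mem_phiHatDomain hQ hx hr, phiHat_smul hd hP hQ x hr⟩,
    ⟨phiHat d (quad a₁ a₂ b₁ b₂ b₃) P Q, fun x hx => ?_, ?_⟩, fun hev hQX => ?_⟩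
  · exact phiHat_smul hd hP hQ x (inv_pos.2 (Real.sqrt_pos.2 (neg_pos.2 (hV hx))))
  · rw [himage]
    exact isHarmonicMorphismOnHyperbolic_of_minkowski hφ fun x _ r hr => phiHat_smul hd hP hQ x hr
  · have hdom : phiHatDomain d (quad a₁ a₂ b₁ b₂ b₃) Q = timelikeCone (2 * n + 2) := by
      rw [hQX]
      exact phiHatDomain_eq_timelikeCone hn hev _
    refine ⟨hdom, ?_⟩
    rw [himage, hdom]
    refine Set.inter_eq_right.2 fun x hx => ?_
    have h : lorentz x x = -1 := hx
    exact h.trans_lt (by norm_num)
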